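/- **Theorem A.** For real sequences $(a_\nu)_{\nu\ge1}$, $(b_\nu)_{\nu\ge0}$, the convergents of the continued fraction $$b_0+\cfrac{a_1}{b_1+\cfrac{a_2}{b_2+\cdots}}$$ are the quotients $P_\nu/Q_\nu$, $\nu\ge0$, where $P_{-1}=1$, $Q_{-1}=0$, $P_0=b_0$, $Q_0=1$, and $P_\nu=b_\nu P_{\nu-1}+a_\nu P_{\nu-2}$, $Q_\nu=b_\nu Q_{\nu-1}+a_\nu Q_{\nu-2}$ for $\nu\ge1$. The continued fraction is said to have the value $x$ if $Q_\nu\neq0$ for all $\nu\ge 0$ and $P_\nu/Q_\nu\to x$ as $\nu\to\infty$. Each of the following two continued fractions has the value $2\zeta(3)$, where $\zeta$ is the Riemann zeta function. 1. $b_0=3$, $a_1=-81$, $a_\nu=-(\nu-1)^3\nu^3(4\nu^2-4\nu-3)^3$ for $\nu\ge2$, and $b_\nu=4(68\nu^6-45\nu^4+12\nu^2-1)$ for $\nu\ge1$. 2. $b_0=2$, $a_1=42$, $a_\nu=-(\nu-1)^3\nu^3(4\nu^2-4\nu-3)\bigl((\nu+1)^3-\nu^3\bigr)\bigl((\nu-1)^3-(\nu-2)^3\bigr)$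 for $\nu\ge2$, and $b_\nu=2(102\nu^6-68\nu^4+21\nu^2-3)$ for $\nu\ge1$. Moreover, for each of the two continued fractions and every $\varepsilon>0$ there are constants $C_1,C_2>0$, depending only on $\varepsilon$, such that for all $\nu\ge0$ $$\frac{C_1}{(1+\sqrt2)^{8\nu(1+\varepsilon)}}\le\left|2\zeta(3)-\frac{P_\nu}{Q_\nu}\right|\le\frac{C_2}{(1+\sqrt2)^{8\nu(1-\varepsilon)}}.$$ -/

import Mathlib

/-- The generalized continued fraction `b 0 + a 1 / (b 1 + a 2 / (b 2 + ⋯))`.  The value `a 0` is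
not used. -/
noncomputable def contFracOf (a b : ℕ → ℝ) : GenContFract ℝ where
  h := b 0
  s := Stream'.Seq.ofStream fun n => ⟨a (n + 1), b (n + 1)⟩

/-- Partial numerators of the first continued fraction (the value at `0` is not used). -/
noncomputable def aOne (ν : ℕ) : ℝ :=
  if ν = 1 then -81
  else -((ν : ℝ) - 1) ^ 3 * (ν : ℝ) ^ 3 * (4 * (ν : ℝ) ^ 2 - 4 * (ν : ℝ) - 3) ^ 3

/-- Partial denominators of the first continued fraction. -/
noncomputable def bOne (ν : ℕ) : ℝ :=
  if ν = 0 then 3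
  else 4 * (68 * (ν : ℝ) ^ 6 - 45 * (ν : ℝ) ^ 4 + 12 * (ν : ℝ) ^ 2 - 1)

/-- Partial numerators of the second continued fraction (the value at `0` is not used). -/
noncomputable def aTwo (ν : ℕ) : ℝ :=
  if ν = 1 then 42
  else -((ν : ℝ) - 1) ^ 3 * (ν : ℝ) ^ 3 * (4 * (ν : ℝ) ^ 2 - 4 * (ν : ℝ) - 3) *
    (((ν : ℝ) + 1) ^ 3 - (ν : ℝ) ^ 3) * (((ν : ℝ) - 1) ^ 3 - ((ν : ℝ) - 2) ^ 3)

/-- Partial denominators of the second continued fraction. -/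
noncomputable def bTwo (ν : ℕ) : ℝ :=
  if ν = 0 then 2
  else 2 * (102 * (ν : ℝ) ^ 6 - 68 * (ν : ℝ) ^ 4 + 21 * (ν : ℝ) ^ 2 - 3)

/-- The infinite continued fraction `g` has the value `x`: every convergent is defined (its
denominator does not vanish), and the convergents tend to `x`. -/
def ExpandsTo (g : GenContFract ℝ) (x : ℂ) : Prop :=
  (∀ ν : ℕ, g.dens ν ≠ 0) ∧
    Filter.Tendsto (fun ν : ℕ => ((g.convs ν : ℝ) : ℂ)) Filter.atTop (nhds x)

/-- The `ν`-th convergent of `g` differs from `x` by about `(1 + √2) ^ (-8 ν)`: up to an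
arbitrarily small relative change of the exponent and constant factors, from above and from
below. -/
def HasErrorRate (g : GenContFract ℝ) (x : ℂ) : Prop :=
  ∀ ε : ℝ, 0 < ε → ∃ C₁ C₂ : ℝ, 0 < C₁ ∧ 0 < C₂ ∧ ∀ ν : ℕ,
    C₁ / (1 + √2) ^ (8 * (ν : ℝ) * (1 + ε)) ≤ ‖x - ((g.convs ν : ℝ) : ℂ)‖ ∧
      ‖x - ((g.convs ν : ℝ) : ℂ)‖ ≤ C₂ / (1 + √2) ^ (8 * (ν : ℝ) * (1 - ε))

/-! Write A_n for the Apéry numbers and B_n for their companions. Both solve Apéry's recurrence, and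
B_n / A_n → ζ(3). The denominators of the two continued fractions are, up to an explicit nonzero
gauge factor, A_{n+1} - A_n and A_{n+1} + A_n. The numerators are twice the same combinations of the
B_n, with the same factor. The gauge cancels in the convergents, leaving a question about Apéry's
sequences (`expandsTo_and_hasErrorRate_of_apery`).

The Casoratian is exactly 6 / (n+1)^3. Hence ζ(3) - B_n / A_n is a sum of positive, geometrically
decreasing terms, comparable to its first one (`aperyRemainder_bounds`). Passing to sums or
differences keeps the order 1 / ((n+1)^3 A_{n+1}^2), because R_n = ζ(3) A_n - B_n dominates R_{n+1}
while A_{n+1} dominates A_n. Finally A_{n+1} / A_n → (1+√2)^4 (`tendsto_aperyNum_ratio`) gives the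
rate (1+√2)^8. -/

open Finset Filter Topology

/-! ### Apéry's terms and weights -/

/-- The product `C(n, k) C(n + k, k)`. -/
noncomputable def aperyTerm (n k : ℕ) : ℝ := (n.choose k : ℝ) * ((n + k).choose k : ℝ)

/-- The weights in the companions of the Apéry numbers. -/
noncomputable def aperyWeight (n k : ℕ) : ℝ :=
  ∑ m ∈ range n, 1 / ((m : ℝ) + 1) ^ 3 +
    ∑ m ∈ range k, (-1) ^ m / (2 * ((m : ℝ) + 1) ^ 3 * aperyTerm n (m + 1))

/-- The Apéry numbers. -/
noncomputable def aperyNum (n : ℕ) : ℝ := ∑ k ∈ range (n + 1), aperyTerm n k ^ 2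

/-- The numerators of Apéry's approximations to `ζ(3)`. -/
noncomputable def aperyCompanion (n : ℕ) : ℝ :=
  ∑ k ∈ range (n + 1), aperyTerm n k ^ 2 * aperyWeight n k

theorem aperyTerm_eq_zero {n k : ℕ} (h : n < k) : aperyTerm n k = 0 := by
  simp [aperyTerm, Nat.choose_eq_zero_of_lt h]

theorem aperyTerm_add (k j : ℕ) :
    aperyTerm (k + j) k = ((k + j + k).factorial : ℝ) / ((k.factorial : ℝ) ^ 2 * j.factorial) := by
  have h1 := Nat.add_choose_mul_factorial_mul_factorial k j
  have h2 := Nat.add_choose_mul_factorial_mul_factorial (k + j) k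
  rw [aperyTerm, eq_div_iff (by positivity)]
  have e1 : (((k + j).choose k : ℕ) : ℝ) * k.factorial * j.factorial = (k + j).factorial := by
    rw [Nat.choose_symm_add]
    exact_mod_cast h1
  have e2 : (((k + j + k).choose k : ℕ) : ℝ) * (k + j).factorial * k.factorial
      = (k + j + k).factorial := by
    exact_mod_cast h2
  rw [← e2, ← e1]
  ring

theorem aperyTerm_zero (n : ℕ) : aperyTerm n 0 = 1 := by simp [aperyTerm]

theorem aperyTerm_pos {n k : ℕ} (h : k ≤ n) : 0 < aperyTerm n k := by
  have h1 : 0 < n.choose k := Nat.choose_pos h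
  have h2 : 0 < (n + k).choose k := Nat.choose_pos (by omega)
  unfold aperyTerm
  positivity

/-- The cross-multiplied form stays valid at and beyond the boundary k = n + 1. -/
theorem aperyTerm_succ_left (n k : ℕ) :
    ((n : ℝ) + 1 - k) * aperyTerm (n + 1) k = (n + 1 + k) * aperyTerm n k := by
  rcases lt_trichotomy (n + 1) k with h | h | h
  · rw [aperyTerm_eq_zero h, aperyTerm_eq_zero (by omega : n < k)]; simp
  · rw [aperyTerm_eq_zero (by omega : n < k)]
    have : (n : ℝ) + 1 - k = 0 := by rw [← h]; push_cast; ring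
    rw [this]; simp
  · obtain ⟨j, rfl⟩ := Nat.exists_eq_add_of_le (by omega : k ≤ n)
    have e1 := aperyTerm_add k j
    have e2 := aperyTerm_add k (j + 1)
    rw [← add_assoc] at e2
    rw [e1, e2, show k + j + 1 + k = (k + j + k) + 1 by ring, Nat.factorial_succ,
      Nat.factorial_succ]
    push_cast
    field_simp
    ring

theorem aperyTerm_succ_right (n k : ℕ) :
    ((k : ℝ) + 1) ^ 2 * aperyTerm n (k + 1) = ((n : ℝ) - k) * (n + k + 1) * aperyTerm n k := by
  rcases lt_trichotomy n k with h | h | h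
  · rw [aperyTerm_eq_zero h, aperyTerm_eq_zero (by omega : n < k + 1)]; simp
  · rw [aperyTerm_eq_zero (by omega : n < k + 1)]
    subst h; simp
  · obtain ⟨j, rfl⟩ := Nat.exists_eq_add_of_le (by omega : k + 1 ≤ n)
    have e1 := aperyTerm_add k (j + 1)
    have e2 := aperyTerm_add (k + 1) j
    rw [show k + (j + 1) = k + 1 + j by ring] at e1
    rw [e1, e2, show k + 1 + j + (k + 1) = (k + 1 + j + k) + 1 by ring, Nat.factorial_succ,
      Nat.factorial_succ k, Nat.factorial_succ j]
    push_cast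
    field_simp
    ring

/-- A common factor of the values of `aperyTerm` near `(n + 1, k)`. -/
theorem exists_aperyTerm_factor {n k : ℕ} (h : k ≤ n + 1) :
    ∃ w : ℝ, 0 < w ∧ aperyTerm (n + 2) (k + 1) = (n + k + 3) * (n + k + 2) * w ∧
      aperyTerm (n + 1) (k + 1) = (n + k + 2) * (n + 1 - k) * w ∧
      aperyTerm n (k + 1) = (n + 1 - k) * (n - k) * w ∧
      aperyTerm (n + 1) k = ((k : ℝ) + 1) ^ 2 * w := by
  have hk : (0 : ℝ) < (k : ℝ) + 1 := by positivity
  have hw := aperyTerm_pos h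
  refine ⟨aperyTerm (n + 1) k / ((k : ℝ) + 1) ^ 2, by positivity, ?_, ?_, ?_, ?_⟩
  · have h1 := aperyTerm_succ_right (n + 2) k
    have h2 := aperyTerm_succ_left (n + 1) k
    push_cast at h1 h2
    field_simp
    linear_combination h1 + (n + k + 3) * h2
  · have h1 := aperyTerm_succ_right (n + 1) k
    push_cast at h1
    field_simp
    linear_combination h1
  · have h1 := aperyTerm_succ_right n k
    have h2 := aperyTerm_succ_left n k
    field_simp
    linear_combination h1 - (n - k) * h2
  · field_simp

theorem aperyWeight_succ_right {n k : ℕ} (h : k + 1 ≤ n) :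
    aperyTerm n (k + 1) * (aperyWeight n (k + 1) - aperyWeight n k) =
      (-1) ^ k / (2 * ((k : ℝ) + 1) ^ 3) := by
  have := (aperyTerm_pos h).ne'
  rw [aperyWeight, aperyWeight, sum_range_succ _ k]
  field_simp
  ring

/-- At k = 0 the difference is the single new term 1 / (n+1)^3, and its increments in k telescope.
This closed form is what lets the recurrence pass to the companions. -/
theorem aperyWeight_succ_left {n k : ℕ} (h : k ≤ n) :
    aperyTerm n k * (aperyWeight (n + 1) k - aperyWeight n k) =
      (-1) ^ k / (((n : ℝ) + 1) ^ 2 * (n + 1 + k)) := by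
  induction k with
  | zero =>
    simp only [aperyTerm_zero, aperyWeight, sum_range_succ, range_zero, sum_empty]
    push_cast
    field_simp
    ring
  | succ k ih =>
    have ih := ih (by omega)
    have p1 := aperyTerm_pos h
    have h1 := aperyWeight_succ_right h
    have h2 := aperyWeight_succ_right (by omega : k + 1 ≤ n + 1)
    have r1 := aperyTerm_succ_right n k
    have r2 := aperyTerm_succ_left n (k + 1)
    push_cast at r1 r2
    have hnk : (0 : ℝ) < (n : ℝ) - k := by
      have : ((k + 1 : ℕ) : ℝ) ≤ n := by exact_mod_cast h
      push_cast at this; linarith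
    -- The increments at n and n + 1 and the induction hypothesis carry three different terms; all
    -- are rewritten through `aperyTerm n (k + 1)`.
    have e1 : aperyTerm (n + 1) (k + 1) = (n + k + 2) / (n - k) * aperyTerm n (k + 1) := by
      field_simp; linear_combination r2
    have e2 : aperyTerm n k = ((k : ℝ) + 1) ^ 2 / ((n - k) * (n + k + 1)) * aperyTerm n (k + 1) := by
      field_simp; linear_combination -r1
    rw [e1] at h2
    rw [e2] at ih
    set t := aperyTerm n (k + 1)
    have key : t * (aperyWeight (n + 1) (k + 1) - aperyWeight n (k + 1)) =
      (n - k) / (n + k + 2) * ((-1) ^ k / (2 * ((k : ℝ) + 1) ^ 3))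
      - (-1) ^ k / (2 * ((k : ℝ) + 1) ^ 3)
      + ((n - k) * (n + k + 1)) / ((k : ℝ) + 1) ^ 2 *
        ((-1) ^ k / (((n : ℝ) + 1) ^ 2 * (n + 1 + k))) := by
      rw [← ih]
      nth_rewrite 1 [← h2]
      rw [← h1]
      field_simp
      ring
    rw [key, pow_succ]
    push_cast
    field_simp
    ring

theorem aperyTerm_sq_mul_aperyWeight_succ_left (n k : ℕ) :
    aperyTerm n k ^ 2 * (aperyWeight (n + 1) k - aperyWeight n k) =
      aperyTerm n k * ((-1) ^ k / (((n : ℝ) + 1) ^ 2 * (n + 1 + k))) := by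
  rcases le_or_gt k n with h | h
  · rw [← aperyWeight_succ_left h]; ring
  · simp [aperyTerm_eq_zero h]

/-! ### Apéry's recurrence by creative telescoping -/

/-- The middle coefficient of Apéry's recurrence. -/
def aperyPoly (x : ℝ) : ℝ := 34 * x ^ 3 + 51 * x ^ 2 + 27 * x + 5

theorem aperyNum_eq_sum {n N : ℕ} (h : n < N) :
    aperyNum n = ∑ k ∈ range N, aperyTerm n k ^ 2 := by
  refine sum_subset (by simpa using h) fun k _ hk => ?_
  rw [aperyTerm_eq_zero (by simp at hk; omega)]; simp

theorem aperyCompanion_eq_sum {n N : ℕ} (h : n < N) :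
    aperyCompanion n = ∑ k ∈ range N, aperyTerm n k ^ 2 * aperyWeight n k := by
  refine sum_subset (by simpa using h) fun k _ hk => ?_
  rw [aperyTerm_eq_zero (by simp at hk; omega)]; simp

/-- The right side is the telescoping certificate; at N = n + 2 it vanishes with `aperyTerm (n + 1)
N`. -/
theorem aperyNum_partial_sum (n : ℕ) {N : ℕ} (hN : N ≤ n + 2) :
    ∑ k ∈ range (N + 1), (((n : ℝ) + 2) ^ 3 * aperyTerm (n + 2) k ^ 2
      - aperyPoly (n + 1) * aperyTerm (n + 1) k ^ 2 + ((n : ℝ) + 1) ^ 3 * aperyTerm n k ^ 2) =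
    4 * (2 * n + 3) * (N * (2 * N + 1) - (2 * (n : ℝ) + 3) ^ 2) * aperyTerm (n + 1) N ^ 2 := by
  induction N with
  | zero => simp [aperyTerm_zero, aperyPoly]; ring
  | succ k ih =>
    rw [sum_range_succ, ih (by omega)]
    obtain ⟨w, -, e2, e1, e0, e⟩ := exists_aperyTerm_factor (by omega : k ≤ n + 1)
    rw [e2, e1, e0, e, aperyPoly]
    push_cast
    ring

theorem aperyNum_recurrence (n : ℕ) :
    ((n : ℝ) + 2) ^ 3 * aperyNum (n + 2) - aperyPoly (n + 1) * aperyNum (n + 1)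
      + ((n : ℝ) + 1) ^ 3 * aperyNum n = 0 := by
  have h := aperyNum_partial_sum n le_rfl
  rw [aperyTerm_eq_zero (by omega : n + 1 < n + 2)] at h
  rw [aperyNum_eq_sum (by omega : n + 2 < n + 2 + 1), aperyNum_eq_sum (by omega : n + 1 < n + 2 + 1),
    aperyNum_eq_sum (by omega : n < n + 2 + 1), mul_sum, mul_sum, mul_sum, ← sum_sub_distrib,
    ← sum_add_distrib, h]
  ring

/-- The same certificate times the weight, plus a correction absorbing the variation of the weights
in n and k. -/
theorem aperyCompanion_partial_sum (n : ℕ) {N : ℕ} (hN : N ≤ n + 2) :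
    ∑ k ∈ range (N + 1), (((n : ℝ) + 2) ^ 3 * (aperyTerm (n + 2) k ^ 2 * aperyWeight (n + 2) k)
      - aperyPoly (n + 1) * (aperyTerm (n + 1) k ^ 2 * aperyWeight (n + 1) k)
      + ((n : ℝ) + 1) ^ 3 * (aperyTerm n k ^ 2 * aperyWeight n k)) =
    4 * (2 * n + 3) * (N * (2 * N + 1) - (2 * (n : ℝ) + 3) ^ 2) *
      (aperyTerm (n + 1) N ^ 2 * aperyWeight (n + 1) N)
      - 5 * (2 * n + 3) * (-1) ^ N * N / (((n : ℝ) + 1) * (n + 2)) * aperyTerm (n + 1) N := by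
  induction N with
  | zero =>
    simp only [zero_add, aperyTerm_zero, aperyPoly, aperyWeight, sum_range_succ,
      range_zero, sum_empty]
    push_cast
    field_simp
    ring
  | succ k ih =>
    rw [sum_range_succ, ih (by omega)]
    obtain ⟨w, hw, e2, e1, e0, e⟩ := exists_aperyTerm_factor (by omega : k ≤ n + 1)
    have d1 := aperyTerm_sq_mul_aperyWeight_succ_left (n + 1) (k + 1)
    have d1' := aperyTerm_sq_mul_aperyWeight_succ_left (n + 1) k
    have d0 := aperyTerm_sq_mul_aperyWeight_succ_left n (k + 1)
    have dk := aperyWeight_succ_right (by omega : k + 1 ≤ n + 2)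
    -- The weights change from n + 1 to n + 2 but the terms stay at n, so one factor is first moved
    -- to n + 1.
    have d01 : aperyTerm n (k + 1) ^ 2 * (aperyWeight (n + 2) (k + 1) - aperyWeight (n + 1) (k + 1))
        = aperyTerm n (k + 1) * (((n - k) / (n + k + 2)) *
          ((-1) ^ (k + 1) / (((n : ℝ) + 2) ^ 2 * (n + k + 3)))) := by
      rcases le_or_gt (k + 1) n with h | h
      · have h1 := aperyWeight_succ_left (by omega : k + 1 ≤ n + 1)
        have h2 : aperyTerm n (k + 1) = (n - k) / (n + k + 2) * aperyTerm (n + 1) (k + 1) := by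
          rw [e0, e1]; field_simp
        have h3 : (-1 : ℝ) ^ (k + 1) / (((n : ℝ) + 2) ^ 2 * (n + k + 3)) =
          (-1) ^ (k + 1) / ((((n + 1 : ℕ) : ℝ) + 1) ^ 2 * (((n + 1 : ℕ) : ℝ) + 1 + (k + 1 : ℕ))) := by
          congr 1; push_cast; ring
        rw [h3, ← h1, pow_two]
        nth_rewrite 2 [h2]
        ring
      · simp [aperyTerm_eq_zero h]
    have dk' : w * (aperyWeight (n + 2) (k + 1) - aperyWeight (n + 2) k) =
        (-1) ^ k / (2 * ((k : ℝ) + 1) ^ 3 * ((n + k + 3) * (n + k + 2))) := by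
      rw [e2] at dk
      rw [← div_div, ← dk]
      field_simp
    rw [e1] at d1
    rw [e] at d1'
    rw [e0] at d0 d01
    rw [e2, e1, e0, e, aperyPoly]
    rw [pow_succ] at d1 d0 d01
    rw [pow_succ (-1 : ℝ)]
    push_cast at d1 d1' d0 ⊢
    -- Every weight is referred to `aperyWeight (n + 2) (k + 1)`, whose coefficient vanishes by the
    -- certificate for the Apéry numbers; a rational identity remains.
    linear_combination (norm := skip)
      (34 * ((n : ℝ) + 1) ^ 3 + 51 * ((n : ℝ) + 1) ^ 2 + 27 * ((n : ℝ) + 1) + 5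
        + 4 * (2 * n + 3) * ((k + 1) * (2 * (k + 1) + 1) - (2 * (n : ℝ) + 3) ^ 2)) * d1
      - ((n : ℝ) + 1) ^ 3 * d0 - ((n : ℝ) + 1) ^ 3 * d01
      - 4 * (2 * n + 3) * (k * (2 * k + 1) - (2 * (n : ℝ) + 3) ^ 2) * d1'
      - 4 * (2 * n + 3) * (k * (2 * k + 1) - (2 * (n : ℝ) + 3) ^ 2) * (k + 1) ^ 4 * w * dk'
    field_simp
    ring

theorem aperyCompanion_recurrence (n : ℕ) :
    ((n : ℝ) + 2) ^ 3 * aperyCompanion (n + 2) - aperyPoly (n + 1) * aperyCompanion (n + 1)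
      + ((n : ℝ) + 1) ^ 3 * aperyCompanion n = 0 := by
  have h := aperyCompanion_partial_sum n le_rfl
  rw [aperyTerm_eq_zero (by omega : n + 1 < n + 2)] at h
  rw [aperyCompanion_eq_sum (by omega : n + 2 < n + 2 + 1),
    aperyCompanion_eq_sum (by omega : n + 1 < n + 2 + 1),
    aperyCompanion_eq_sum (by omega : n < n + 2 + 1), mul_sum, mul_sum, mul_sum, ← sum_sub_distrib,
    ← sum_add_distrib, h]
  ring

theorem aperyNum_zero : aperyNum 0 = 1 := by simp [aperyNum, aperyTerm]

theorem aperyNum_one : aperyNum 1 = 5 := by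
  norm_num [aperyNum, aperyTerm, sum_range_succ]

theorem aperyNum_two : aperyNum 2 = 73 := by
  norm_num [aperyNum, aperyTerm, sum_range_succ, Nat.choose]

theorem aperyCompanion_zero : aperyCompanion 0 = 0 := by
  simp [aperyCompanion, aperyWeight]

theorem aperyCompanion_one : aperyCompanion 1 = 6 := by
  norm_num [aperyCompanion, aperyTerm, aperyWeight, sum_range_succ]

theorem aperyCompanion_two : aperyCompanion 2 = 351 / 4 := by
  norm_num [aperyCompanion, aperyTerm, aperyWeight, sum_range_succ, Nat.choose]

/-! ### Growth and Casoratian -/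

theorem aperyNum_pos (n : ℕ) : 0 < aperyNum n := by
  refine sum_pos (fun k hk => ?_) (by simp)
  have := aperyTerm_pos (by simp at hk; omega : k ≤ n)
  positivity

theorem five_mul_aperyNum_le (n : ℕ) : 5 * aperyNum n ≤ aperyNum (n + 1) := by
  induction n with
  | zero => rw [zero_add, aperyNum_zero, aperyNum_one]; norm_num
  | succ n ih =>
    have hr := aperyNum_recurrence n
    have h0 := aperyNum_pos n
    have h1 := aperyNum_pos (n + 1)
    have hn : (0 : ℝ) ≤ n := n.cast_nonneg
    have h3 : (0 : ℝ) ≤ ((n : ℝ) + 1) ^ 3 * (aperyNum (n + 1) - aperyNum n) :=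
      mul_nonneg (by positivity) (by linarith)
    have h4 : 0 ≤ (aperyPoly (n + 1) - ((n : ℝ) + 1) ^ 3 - 5 * ((n : ℝ) + 2) ^ 3)
        * aperyNum (n + 1) := by
      refine mul_nonneg ?_ h1.le
      have : aperyPoly (n + 1) - ((n : ℝ) + 1) ^ 3 - 5 * ((n : ℝ) + 2) ^ 3
        = 28 * (n : ℝ) ^ 3 + 120 * (n : ℝ) ^ 2 + 168 * n + 76 := by unfold aperyPoly; ring
      rw [this]; positivity
    refine le_of_mul_le_mul_left (a := ((n : ℝ) + 2) ^ 3) ?_ (by positivity)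
    linarith

/-- Eliminating the middle terms of the two recurrences shows that this quantity does not depend on
n. -/
theorem apery_casoratian (n : ℕ) :
    ((n : ℝ) + 1) ^ 3 * (aperyCompanion (n + 1) * aperyNum n - aperyCompanion n * aperyNum (n + 1))
      = 6 := by
  induction n with
  | zero =>
    simp only [zero_add, aperyNum_zero, aperyNum_one, aperyCompanion_zero, aperyCompanion_one]
    norm_num
  | succ n ih =>
    have h1 := aperyNum_recurrence n
    have h2 := aperyCompanion_recurrence n
    push_cast
    linear_combination ih + aperyNum (n + 1) * h2 - aperyCompanion (n + 1) * h1

/-! ### Convergence to ζ(3) -/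

/-- The real number `ζ(3)`. -/
noncomputable def realZetaThree : ℝ := ∑' m : ℕ, 1 / ((m : ℝ) + 1) ^ 3

theorem summable_inv_cube : Summable fun m : ℕ => 1 / ((m : ℝ) + 1) ^ 3 := by
  have h := (summable_nat_add_iff 1).2 (Real.summable_one_div_nat_pow.2 (by norm_num : 1 < 3))
  simpa using h

theorem riemannZeta_three : riemannZeta 3 = (realZetaThree : ℂ) := by
  have h := zeta_nat_eq_tsum_of_gt_one (by norm_num : 1 < 3)
  have h2 : Summable fun n : ℕ => 1 / (n : ℂ) ^ 3 := by
    have := Real.summable_one_div_nat_pow.2 (by norm_num : 1 < 3)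
    have h3 := Complex.ofRealCLM.summable this
    simpa using h3
  rw [h2.tsum_eq_zero_add] at h
  rw [realZetaThree, Complex.ofReal_tsum]
  push_cast at h ⊢
  simpa using h

theorem succ_le_aperyTerm {n m : ℕ} (h : m + 1 ≤ n) : (n : ℝ) + 1 ≤ aperyTerm n (m + 1) := by
  have h1 : 1 ≤ n.choose (m + 1) := Nat.choose_pos h
  have h2 : n + 1 ≤ (n + (m + 1)).choose (m + 1) := by
    calc n + 1 = (n + 1).choose n := by simp
      _ ≤ (n + (m + 1)).choose n := Nat.choose_le_choose n (by omega)
      _ = _ := Nat.choose_symm_add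
  have h3 : n + 1 ≤ n.choose (m + 1) * (n + (m + 1)).choose (m + 1) := by nlinarith
  unfold aperyTerm
  exact_mod_cast h3

/-- Uniformity in k is the point: B_n / A_n averages the weights, so it inherits the bound. -/
theorem abs_aperyWeight_sub_le {n k : ℕ} (h : k ≤ n) :
    |aperyWeight n k - ∑ m ∈ range n, 1 / ((m : ℝ) + 1) ^ 3| ≤ realZetaThree / (n + 1) := by
  rw [aperyWeight, add_sub_cancel_left]
  calc _ ≤ ∑ m ∈ range k, 1 / ((m : ℝ) + 1) ^ 3 / ((n : ℝ) + 1) := by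
        refine (abs_sum_le_sum_abs _ _).trans (sum_le_sum fun m hm => ?_)
        have h1 := succ_le_aperyTerm (by simp at hm; omega : m + 1 ≤ n)
        have h2 : (0 : ℝ) < (n : ℝ) + 1 := by positivity
        have h3 : 0 < aperyTerm n (m + 1) := by linarith
        rw [abs_div, abs_pow, abs_neg, abs_one, one_pow, abs_of_pos (by positivity), div_div]
        refine one_div_le_one_div_of_le (by positivity) ?_
        have : (0 : ℝ) < ((m : ℝ) + 1) ^ 3 := by positivity
        nlinarith
    _ = (∑ m ∈ range k, 1 / ((m : ℝ) + 1) ^ 3) / ((n : ℝ) + 1) := by rw [sum_div]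
    _ ≤ _ := by
        gcongr
        exact summable_inv_cube.sum_le_tsum _ fun m _ => by positivity

theorem tendsto_div_natCast_add_one (C : ℝ) :
    Tendsto (fun n : ℕ => C / ((n : ℝ) + 1)) atTop (𝓝 0) := by
  have h := (tendsto_const_div_atTop_nhds_zero_nat C).comp (tendsto_add_atTop_nat 1)
  refine h.congr fun n => ?_
  simp

theorem tendsto_aperyCompanion_div_aperyNum :
    Tendsto (fun n => aperyCompanion n / aperyNum n) atTop (𝓝 realZetaThree) := by
  have h1 : Tendsto (fun n => ∑ m ∈ range n, 1 / ((m : ℝ) + 1) ^ 3) atTop (𝓝 realZetaThree) :=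
    summable_inv_cube.hasSum.tendsto_sum_nat
  have h2 : Tendsto (fun n : ℕ => realZetaThree / ((n : ℝ) + 1)) atTop (𝓝 0) :=
    tendsto_div_natCast_add_one realZetaThree
  have h3 : Tendsto (fun n => aperyCompanion n / aperyNum n - ∑ m ∈ range n, 1 / ((m : ℝ) + 1) ^ 3)
      atTop (𝓝 0) := by
    refine squeeze_zero_norm (fun n => ?_) h2
    have hA := aperyNum_pos n
    rw [Real.norm_eq_abs, div_sub' hA.ne', abs_div, abs_of_pos hA, div_le_iff₀ hA, aperyCompanion,
      aperyNum, sum_mul, ← sum_sub_distrib, mul_sum]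
    refine (abs_sum_le_sum_abs _ _).trans (sum_le_sum fun k hk => ?_)
    rw [← mul_sub, abs_mul, abs_of_nonneg (by positivity), mul_comm]
    gcongr
    exact abs_aperyWeight_sub_le (by simp at hk; omega)
  simpa using h3.add h1

/-! ### Size of the remainder -/

/-- The remainder `ζ(3) A - B` of Apéry's approximation. -/
noncomputable def aperyRemainder (n : ℕ) : ℝ := realZetaThree * aperyNum n - aperyCompanion n

theorem aperyRemainder_bounds (n : ℕ) :
    6 / (((n : ℝ) + 1) ^ 3 * aperyNum (n + 1)) ≤ aperyRemainder n ∧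
      aperyRemainder n ≤ 25 / 24 * (6 / (((n : ℝ) + 1) ^ 3 * aperyNum (n + 1))) := by
  set t : ℕ → ℝ := fun n => realZetaThree - aperyCompanion n / aperyNum n with ht
  -- `u` is the Casoratian divided by A_n A_{n+1}, so t_n is the tail sum of `u`. Successive terms
  -- shrink by at least 5² = 25, and 25/24 = 1 / (1 - 1/25).
  set u : ℕ → ℝ := fun n => 6 / (((n : ℝ) + 1) ^ 3 * aperyNum (n + 1) * aperyNum n) with hu
  have hupos : ∀ n, 0 < u n := fun n => by
    have := aperyNum_pos n
    have := aperyNum_pos (n + 1)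
    simp only [hu]; positivity
  have htlim : Tendsto t atTop (𝓝 0) := by
    simpa using tendsto_aperyCompanion_div_aperyNum.const_sub realZetaThree
  have hstep : ∀ n, t n - t (n + 1) = u n := fun n => by
    have h0 := (aperyNum_pos n).ne'
    have h1 := (aperyNum_pos (n + 1)).ne'
    have := apery_casoratian n
    simp only [ht, hu]
    field_simp
    linear_combination this
  have hdecay : ∀ n, u (n + 1) ≤ u n / 25 := fun n => by
    have h0 := aperyNum_pos n
    have h1 := aperyNum_pos (n + 1)
    have h2 := five_mul_aperyNum_le n
    have h3 := five_mul_aperyNum_le (n + 1)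
    have e : u n / 25 = 6 / (((n : ℝ) + 1) ^ 3 * (5 * aperyNum (n + 1)) * (5 * aperyNum n)) := by
      simp only [hu]; field_simp; norm_num
    rw [e]
    simp only [hu]
    push_cast
    have h4 : (n : ℝ) + 1 ≤ n + 1 + 1 := by linarith
    have h5 : 0 < aperyNum (n + 1 + 1) := aperyNum_pos _
    gcongr
  have hulim : Tendsto u atTop (𝓝 0) := by
    have : u = fun n => t n - t (n + 1) := by ext n; exact (hstep n).symm
    rw [this]
    simpa using htlim.sub (htlim.comp (tendsto_add_atTop_nat 1))
  have hanti : Antitone t := antitone_nat_of_succ_le fun n => by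
    linarith [hstep n, hupos n]
  have hmono : Monotone fun n => t n - 25 / 24 * u n := monotone_nat_of_le_succ fun n => by
    linarith [hstep n, hdecay n]
  have hlow : u n ≤ t n := by
    linarith [hstep n, hanti.le_of_tendsto htlim (n + 1)]
  have hup : t n - 25 / 24 * u n ≤ 0 := by
    have hlim : Tendsto (fun n => t n - 25 / 24 * u n) atTop (𝓝 0) := by
      simpa using htlim.sub (hulim.const_mul (25 / 24))
    exact hmono.ge_of_tendsto hlim n
  have hA := aperyNum_pos n
  have hA1 := aperyNum_pos (n + 1)
  have e1 : aperyRemainder n = aperyNum n * t n := by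
    simp only [aperyRemainder, ht]; field_simp
  have e2 : 6 / (((n : ℝ) + 1) ^ 3 * aperyNum (n + 1)) = aperyNum n * u n := by
    simp only [hu]; field_simp
  rw [e1, e2]
  constructor
  · gcongr
  · nlinarith

theorem aperyRemainder_pos (n : ℕ) : 0 < aperyRemainder n := by
  have := aperyNum_pos (n + 1)
  exact lt_of_lt_of_le (by positivity) (aperyRemainder_bounds n).1

theorem aperyRemainder_succ_le (n : ℕ) : aperyRemainder (n + 1) ≤ aperyRemainder n / 4 := by
  have h1 := aperyNum_pos (n + 1)
  have h3 := five_mul_aperyNum_le (n + 1)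
  refine (aperyRemainder_bounds (n + 1)).2.trans ?_
  have h4 := (aperyRemainder_bounds n).1
  have h5 : 6 / ((((n + 1 : ℕ) : ℝ) + 1) ^ 3 * aperyNum (n + 1 + 1)) ≤
      6 / (((n : ℝ) + 1) ^ 3 * (5 * aperyNum (n + 1))) := by
    push_cast
    gcongr
    linarith
  have h6 : 6 / (((n : ℝ) + 1) ^ 3 * (5 * aperyNum (n + 1))) =
      6 / (((n : ℝ) + 1) ^ 3 * aperyNum (n + 1)) / 5 := by field_simp
  have := aperyRemainder_pos n
  linarith

/-! ### Exponential growth rate -/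

/-- The ratios iterate a perturbation of x ↦ 34 - 1/x, whose larger fixed point is 17 + 12√2 =
(1+√2)^4. As they are at least 5, distances to it contract by 1/5, up to an error O(1/n). -/
theorem tendsto_aperyNum_ratio :
    Tendsto (fun n => aperyNum (n + 1) / aperyNum n) atTop (𝓝 ((1 + √2) ^ 4)) := by
  set L : ℝ := (1 + √2) ^ 4 with hL
  have hs : √2 ^ 2 = 2 := Real.sq_sqrt (by norm_num)
  have hLe : L = 17 + 12 * √2 := by
    rw [hL]; linear_combination (√2 ^ 2 + 4 * √2 + 8) * hs
  have hL1 : 1 ≤ L := by rw [hLe]; linarith [Real.sqrt_nonneg 2]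
  have hLq : L * L = 34 * L - 1 := by rw [hLe]; linear_combination 144 * hs
  set r : ℕ → ℝ := fun n => aperyNum (n + 1) / aperyNum n with hr
  have hr5 : ∀ n, 5 ≤ r n := fun n => by
    simp only [hr]
    rw [le_div_iff₀ (aperyNum_pos n)]; exact five_mul_aperyNum_le n
  have hrec : ∀ n : ℕ, r (n + 1) = aperyPoly (n + 1) / ((n : ℝ) + 2) ^ 3
      - ((n : ℝ) + 1) ^ 3 / ((n : ℝ) + 2) ^ 3 / r n := fun n => by
    have h0 := (aperyNum_pos n).ne'
    have h1 := (aperyNum_pos (n + 1)).ne'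
    have := aperyNum_recurrence n
    simp only [hr]
    field_simp
    linear_combination this
  have hstep : ∀ n : ℕ, |r (n + 1) - L| ≤ 60 / ((n : ℝ) + 2) + |r n - L| / 5 := fun n => by
    have h5 := hr5 n
    have hr0 : 0 < r n := by linarith
    have hn : (0 : ℝ) ≤ n := n.cast_nonneg
    have e : r (n + 1) - L = -(34 - aperyPoly (n + 1) / ((n : ℝ) + 2) ^ 3)
        + (1 - ((n : ℝ) + 1) ^ 3 / ((n : ℝ) + 2) ^ 3) / r n + (r n - L) / (r n * L) := by
      rw [hrec]
      have : L ≠ 0 := by linarith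
      field_simp
      linear_combination (-1) * r n * (n + 2) ^ 3 * hLq
    have b1 : |34 - aperyPoly (n + 1) / ((n : ℝ) + 2) ^ 3| ≤ 51 / ((n : ℝ) + 2) := by
      have : 34 - aperyPoly (n + 1) / ((n : ℝ) + 2) ^ 3 =
          (51 * (n : ℝ) ^ 2 + 177 * n + 155) / ((n : ℝ) + 2) ^ 3 := by
        unfold aperyPoly; field_simp; ring
      rw [this, abs_of_nonneg (by positivity), div_le_div_iff₀ (by positivity) (by positivity)]
      nlinarith [mul_nonneg hn hn, mul_nonneg hn (mul_nonneg hn hn)]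
    have b2 : |(1 - ((n : ℝ) + 1) ^ 3 / ((n : ℝ) + 2) ^ 3) / r n| ≤ 9 / ((n : ℝ) + 2) := by
      have : (1 - ((n : ℝ) + 1) ^ 3 / ((n : ℝ) + 2) ^ 3) =
          (3 * (n : ℝ) ^ 2 + 9 * n + 7) / ((n : ℝ) + 2) ^ 3 := by
        field_simp; ring
      rw [this, abs_of_nonneg (by positivity)]
      refine (div_le_self (by positivity) (by linarith)).trans ?_
      rw [div_le_div_iff₀ (by positivity) (by positivity)]
      nlinarith [mul_nonneg hn hn, mul_nonneg hn (mul_nonneg hn hn)]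
    have b3 : |(r n - L) / (r n * L)| ≤ |r n - L| / 5 := by
      rw [abs_div, abs_of_pos (by positivity : 0 < r n * L)]
      gcongr
      nlinarith
    rw [e]
    calc _ ≤ |-(34 - aperyPoly (n + 1) / ((n : ℝ) + 2) ^ 3)|
        + |(1 - ((n : ℝ) + 1) ^ 3 / ((n : ℝ) + 2) ^ 3) / r n| + |(r n - L) / (r n * L)| :=
          abs_add_three _ _ _
      _ ≤ 51 / ((n : ℝ) + 2) + 9 / ((n : ℝ) + 2) + |r n - L| / 5 := by
          rw [abs_neg]; gcongr
      _ = _ := by ring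
  have hbound : ∀ n : ℕ, |r n - L| ≤ (|r 0 - L| + 100) / ((n : ℝ) + 1) := fun n => by
    induction n with
    | zero => simp
    | succ n ih =>
      have hn : (0 : ℝ) ≤ n := n.cast_nonneg
      have hK := abs_nonneg (r 0 - L)
      set K := |r 0 - L| + 100 with hKdef
      -- The induction closes when 60 + 2K/5 ≤ K, that is, K ≥ 100.
      have hK' : 100 ≤ K := by linarith
      have h1 : K / ((n : ℝ) + 1) ≤ 2 * K / ((n : ℝ) + 2) := by
        rw [div_le_div_iff₀ (by positivity) (by positivity)]
        nlinarith
      have h2 : 60 / ((n : ℝ) + 2) + 2 * K / ((n : ℝ) + 2) / 5 ≤ K / ((n : ℝ) + 2) := by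
        rw [div_right_comm, ← add_div]
        gcongr
        linarith
      have h3 : K / (((n + 1 : ℕ) : ℝ) + 1) = K / ((n : ℝ) + 2) := by push_cast; ring
      rw [h3]
      linarith [hstep n]
  have h0 : Tendsto (fun n => r n - L) atTop (𝓝 0) :=
    squeeze_zero_norm (fun n => by simpa using hbound n)
      (tendsto_div_natCast_add_one _)
  simpa using h0.add_const L

/-- The ratio test makes q^n / f n summable, hence bounded. -/
theorem exists_mul_pow_le_of_tendsto_ratio {f : ℕ → ℝ} {L q : ℝ} (hf : ∀ n, 0 < f n)
    (h : Tendsto (fun n => f (n + 1) / f n) atTop (𝓝 L)) (hq : 0 < q) (hqL : q < L) :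
    ∃ C, 0 < C ∧ ∀ n, C * q ^ n ≤ f n := by
  have hL : 0 < L := hq.trans hqL
  have hs : Summable fun n => q ^ n / f n := by
    refine summable_of_ratio_test_tendsto_lt_one (l := q * L⁻¹)
      (by rwa [← div_eq_mul_inv, div_lt_one hL])
      (Eventually.of_forall fun n => (div_pos (pow_pos hq n) (hf n)).ne') ?_
    refine ((h.inv₀ hL.ne').const_mul q).congr fun n => ?_
    have h0 := hf n
    have h1 := hf (n + 1)
    rw [Real.norm_of_nonneg (by positivity), Real.norm_of_nonneg (by positivity)]
    field_simp
    ring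
  obtain ⟨K, hK⟩ := hs.tendsto_atTop_zero.bddAbove_range
  have hK' : ∀ n, q ^ n / f n ≤ K := fun n => hK ⟨n, rfl⟩
  have hKpos : 0 < K := lt_of_lt_of_le (div_pos (pow_pos hq 0) (hf 0)) (hK' 0)
  refine ⟨K⁻¹, inv_pos.2 hKpos, fun n => ?_⟩
  have := hK' n
  rw [div_le_iff₀ (hf n)] at this
  rwa [inv_mul_le_iff₀ hKpos]

theorem exists_le_mul_pow_of_tendsto_ratio {f : ℕ → ℝ} {L q : ℝ} (hf : ∀ n, 0 < f n)
    (h : Tendsto (fun n => f (n + 1) / f n) atTop (𝓝 L)) (hL : 0 < L) (hqL : L < q) :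
    ∃ C, 0 < C ∧ ∀ n, f n ≤ C * q ^ n := by
  have hq : 0 < q := hL.trans hqL
  obtain ⟨C, hC, hCf⟩ := exists_mul_pow_le_of_tendsto_ratio (f := fun n => (f n)⁻¹) (L := L⁻¹)
    (q := q⁻¹) (fun n => inv_pos.2 (hf n))
    ((h.inv₀ hL.ne').congr fun n => by rw [inv_div, inv_div_inv]) (inv_pos.2 hq)
    (by gcongr)
  refine ⟨C⁻¹, inv_pos.2 hC, fun n => ?_⟩
  have := hCf n
  rw [inv_pow, ← div_eq_mul_inv, div_le_iff₀ (by positivity), inv_mul_eq_div,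
    le_div_iff₀ (hf n)] at this
  rw [inv_mul_eq_div, le_div_iff₀ hC]
  linarith

/-- The inverse of the order of magnitude of the error of the convergents. -/
noncomputable def aperyScale (n : ℕ) : ℝ := ((n : ℝ) + 1) ^ 3 * aperyNum (n + 1) ^ 2

theorem aperyScale_pos (n : ℕ) : 0 < aperyScale n := by
  have := aperyNum_pos (n + 1)
  unfold aperyScale
  positivity

theorem tendsto_aperyScale_ratio :
    Tendsto (fun n => aperyScale (n + 1) / aperyScale n) atTop (𝓝 ((1 + √2) ^ 8)) := by
  have h1 : Tendsto (fun n : ℕ => 1 + 1 / ((n : ℝ) + 1)) atTop (𝓝 (1 + 0)) :=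
    (tendsto_div_natCast_add_one 1).const_add 1
  have h2 := (h1.pow 3).mul ((tendsto_aperyNum_ratio.comp (tendsto_add_atTop_nat 1)).pow 2)
  have e : (1 + (0 : ℝ)) ^ 3 * ((1 + √2) ^ 4) ^ 2 = (1 + √2) ^ 8 := by ring
  rw [e] at h2
  refine h2.congr fun n => ?_
  have h0 := (aperyNum_pos (n + 1)).ne'
  simp only [aperyScale, Function.comp_apply]
  push_cast
  field_simp

theorem tendsto_inv_aperyScale : Tendsto (fun n => (aperyScale n)⁻¹) atTop (𝓝 0) := by
  have hL : (1 : ℝ) < (1 + √2) ^ 8 :=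
    one_lt_pow₀ (by linarith [Real.sqrt_pos.2 (zero_lt_two' ℝ)]) (by norm_num)
  have hs : Summable fun n => (aperyScale n)⁻¹ := by
    refine summable_of_ratio_test_tendsto_lt_one (inv_lt_one_of_one_lt₀ hL)
      (Eventually.of_forall fun n => (inv_pos.2 (aperyScale_pos n)).ne') ?_
    refine (tendsto_aperyScale_ratio.inv₀ (by positivity)).congr fun n => ?_
    rw [Real.norm_of_nonneg (inv_pos.2 (aperyScale_pos _)).le,
      Real.norm_of_nonneg (inv_pos.2 (aperyScale_pos _)).le, inv_div, inv_div_inv]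
  exact hs.tendsto_atTop_zero

/-! ### Errors of the combined approximations -/

/-- Apéry's approximations, combined with their successors with a sign. -/
theorem abs_apery_combination_bounds {s : ℝ} (hs : |s| = 1) (n : ℕ) :
    0 < aperyNum (n + 1) + s * aperyNum n ∧
    4 / aperyScale n ≤ |2 * realZetaThree - 2 * (aperyCompanion (n + 1) + s * aperyCompanion n) /
      (aperyNum (n + 1) + s * aperyNum n)| ∧
    |2 * realZetaThree - 2 * (aperyCompanion (n + 1) + s * aperyCompanion n) /
      (aperyNum (n + 1) + s * aperyNum n)| ≤ 32 / aperyScale n := by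
  have h0 := aperyNum_pos n
  have h1 := aperyNum_pos (n + 1)
  have h5 := five_mul_aperyNum_le n
  have r0 := aperyRemainder_pos n
  have r1 := aperyRemainder_pos (n + 1)
  have r4 := aperyRemainder_succ_le n
  obtain ⟨lo, hi⟩ := aperyRemainder_bounds n
  have sA : |s * aperyNum n| = aperyNum n := by rw [abs_mul, hs, one_mul, abs_of_pos h0]
  have sR : |s * aperyRemainder n| = aperyRemainder n := by rw [abs_mul, hs, one_mul, abs_of_pos r0]
  have dlo : 4 / 5 * aperyNum (n + 1) ≤ aperyNum (n + 1) + s * aperyNum n := by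
    linarith [neg_abs_le (s * aperyNum n)]
  have dhi : aperyNum (n + 1) + s * aperyNum n ≤ 2 * aperyNum (n + 1) := by
    linarith [le_abs_self (s * aperyNum n)]
  have dpos : 0 < aperyNum (n + 1) + s * aperyNum n := by linarith
  have nlo : 3 / 4 * aperyRemainder n ≤ |aperyRemainder (n + 1) + s * aperyRemainder n| := by
    have := abs_sub_abs_le_abs_add (s * aperyRemainder n) (aperyRemainder (n + 1))
    rw [sR, abs_of_pos r1, add_comm (s * _)] at this
    linarith
  have nhi : |aperyRemainder (n + 1) + s * aperyRemainder n| ≤ 2 * aperyRemainder n := by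
    have := abs_add_le (aperyRemainder (n + 1)) (s * aperyRemainder n)
    rw [sR, abs_of_pos r1] at this
    linarith
  have e : 2 * realZetaThree - 2 * (aperyCompanion (n + 1) + s * aperyCompanion n) /
      (aperyNum (n + 1) + s * aperyNum n) =
      2 * (aperyRemainder (n + 1) + s * aperyRemainder n) /
        (aperyNum (n + 1) + s * aperyNum n) := by
    unfold aperyRemainder
    field_simp
    ring
  have eS : ∀ c : ℝ, c / aperyScale n * aperyNum (n + 1)
      = c / 6 * (6 / (((n : ℝ) + 1) ^ 3 * aperyNum (n + 1))) := fun c => by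
    unfold aperyScale; field_simp
  have hS := aperyScale_pos n
  -- The estimates give 2 · (3/4) · 6 / 2 = 4.5 ≥ 4 below and 2 · 2 · (25/24) · 6 / (4/5) = 31.25 ≤
  -- 32 above.
  refine ⟨dpos, ?_, ?_⟩
  · rw [e, abs_div, abs_of_pos dpos, le_div_iff₀ dpos, abs_mul, abs_two]
    calc _ ≤ 4 / aperyScale n * (2 * aperyNum (n + 1)) := by gcongr
      _ = 2 * (4 / aperyScale n * aperyNum (n + 1)) := by ring
      _ ≤ _ := by rw [eS]; linarith
  · rw [e, abs_div, abs_of_pos dpos, div_le_iff₀ dpos, abs_mul, abs_two]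
    calc _ ≤ 4 / 5 * (32 / aperyScale n * aperyNum (n + 1)) := by rw [eS]; linarith
      _ = 32 / aperyScale n * (4 / 5 * aperyNum (n + 1)) := by ring
      _ ≤ _ := by gcongr

theorem expandsTo_and_hasErrorRate_of_apery {g : GenContFract ℝ} {G : ℕ → ℝ} {s : ℝ}
    (hs : |s| = 1) (hG : ∀ n, G n ≠ 0)
    (hd : ∀ n, g.dens n = G n * (aperyNum (n + 1) + s * aperyNum n))
    (hn : ∀ n, g.nums n = 2 * (G n * (aperyCompanion (n + 1) + s * aperyCompanion n))) :
    ExpandsTo g (2 * riemannZeta 3) ∧ HasErrorRate g (2 * riemannZeta 3) := by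
  have hc : ∀ n, g.convs n = 2 * (aperyCompanion (n + 1) + s * aperyCompanion n) /
      (aperyNum (n + 1) + s * aperyNum n) := fun n => by
    have := (abs_apery_combination_bounds hs n).1.ne'
    have := hG n
    rw [g.conv_eq_num_div_den, hd, hn]
    field_simp
  have hnorm : ∀ n, ‖2 * riemannZeta 3 - ((g.convs n : ℝ) : ℂ)‖ =
      |2 * realZetaThree - 2 * (aperyCompanion (n + 1) + s * aperyCompanion n) /
      (aperyNum (n + 1) + s * aperyNum n)| := fun n => by
    rw [← hc, riemannZeta_three, ← Real.norm_eq_abs, ← Complex.norm_real]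
    push_cast
    rfl
  have hlo : ∀ n, 4 / aperyScale n ≤ ‖2 * riemannZeta 3 - ((g.convs n : ℝ) : ℂ)‖ := fun n => by
    rw [hnorm]; exact (abs_apery_combination_bounds hs n).2.1
  have hhi : ∀ n, ‖2 * riemannZeta 3 - ((g.convs n : ℝ) : ℂ)‖ ≤ 32 / aperyScale n := fun n => by
    rw [hnorm]; exact (abs_apery_combination_bounds hs n).2.2
  refine ⟨⟨fun n => ?_, ?_⟩, fun ε hε => ?_⟩
  · rw [hd]
    exact mul_ne_zero (hG n) (abs_apery_combination_bounds hs n).1.ne'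
  · rw [tendsto_iff_norm_sub_tendsto_zero]
    refine squeeze_zero (fun n => norm_nonneg _) (fun n => ?_)
      (by simpa using tendsto_inv_aperyScale.const_mul 32)
    rw [norm_sub_rev, ← div_eq_mul_inv]
    exact hhi n
  · have hα : (1 : ℝ) < 1 + √2 := by linarith [Real.sqrt_pos.2 (zero_lt_two' ℝ)]
    have hα0 : (0 : ℝ) < 1 + √2 := by linarith
    have hpow : ∀ (x : ℝ) (n : ℕ), (1 + √2) ^ (8 * (n : ℝ) * x) = ((1 + √2) ^ (8 * x)) ^ n :=
      fun x n => by
        rw [← Real.rpow_natCast, ← Real.rpow_mul hα0.le]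
        congr 1
        ring
    have h8 : (1 + √2) ^ 8 = (1 + √2) ^ (8 : ℝ) := by
      rw [← Real.rpow_natCast]; norm_num
    obtain ⟨c, hcpos, hcle⟩ := exists_mul_pow_le_of_tendsto_ratio aperyScale_pos
      tendsto_aperyScale_ratio (q := (1 + √2) ^ (8 * (1 - ε))) (by positivity)
      (by rw [h8]; exact Real.rpow_lt_rpow_of_exponent_lt hα (by linarith))
    obtain ⟨K, hKpos, hKle⟩ := exists_le_mul_pow_of_tendsto_ratio aperyScale_pos
      tendsto_aperyScale_ratio (q := (1 + √2) ^ (8 * (1 + ε))) (by positivity)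
      (by rw [h8]; exact Real.rpow_lt_rpow_of_exponent_lt hα (by linarith))
    refine ⟨4 / K, 32 / c, by positivity, by positivity, fun n => ⟨?_, ?_⟩⟩
    · refine le_trans ?_ (hlo n)
      rw [hpow, div_div]
      have := aperyScale_pos n
      gcongr
      exact hKle n
    · refine (hhi n).trans ?_
      rw [hpow, div_div]
      gcongr
      exact hcle n

/-! ### Identification of the convergents -/

theorem contFracOf_nums_dens {a b N D : ℕ → ℝ} (hN0 : N 0 = b 0) (hD0 : D 0 = 1)
    (hN1 : N 1 = b 1 * b 0 + a 1) (hD1 : D 1 = b 1)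
    (hN : ∀ n, N (n + 2) = b (n + 2) * N (n + 1) + a (n + 2) * N n)
    (hD : ∀ n, D (n + 2) = b (n + 2) * D (n + 1) + a (n + 2) * D n) (n : ℕ) :
    (contFracOf a b).nums n = N n ∧ (contFracOf a b).dens n = D n := by
  have hs : ∀ n, (contFracOf a b).s.get? n = some ⟨a (n + 1), b (n + 1)⟩ := fun n => rfl
  induction n using Nat.twoStepInduction with
  | zero =>
    rw [GenContFract.zeroth_num_eq_h, GenContFract.zeroth_den_eq_one, hN0, hD0]
    exact ⟨rfl, rfl⟩
  | one =>
    rw [GenContFract.first_num_eq (hs 0), GenContFract.first_den_eq (hs 0), hN1, hD1]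
    exact ⟨rfl, rfl⟩
  | more n ih0 ih1 =>
    rw [GenContFract.nums_recurrence (hs (n + 1)) ih0.1 ih1.1,
      GenContFract.dens_recurrence (hs (n + 1)) ih0.2 ih1.2, hN, hD]
    exact ⟨rfl, rfl⟩

/-- The factor between the denominators of the first continued fraction and the differences of
consecutive Apéry numbers. -/
noncomputable def gaugeOne : ℕ → ℝ
  | 0 => 1 / 4
  | n + 1 => ((n : ℝ) + 2) ^ 3 * (2 * (n : ℝ) + 1) ^ 3 * gaugeOne n

/-- The factor between the denominators of the second continued fraction and the sums of
consecutive Apéry numbers. -/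
noncomputable def gaugeTwo : ℕ → ℝ
  | 0 => 1 / 6
  | n + 1 => ((n : ℝ) + 2) ^ 3 * (2 * (n : ℝ) + 1) * (((n : ℝ) + 1) ^ 3 - (n : ℝ) ^ 3) * gaugeTwo n

theorem gaugeOne_pos (n : ℕ) : 0 < gaugeOne n := by
  induction n with
  | zero => norm_num [gaugeOne]
  | succ n ih => rw [gaugeOne]; positivity

theorem gaugeTwo_pos (n : ℕ) : 0 < gaugeTwo n := by
  induction n with
  | zero => norm_num [gaugeTwo]
  | succ n ih =>
    have : 0 < ((n : ℝ) + 1) ^ 3 - (n : ℝ) ^ 3 := by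
      have : ((n : ℝ) + 1) ^ 3 - (n : ℝ) ^ 3 = 3 * (n : ℝ) ^ 2 + 3 * n + 1 := by ring
      rw [this]; positivity
    rw [gaugeTwo]; positivity

/-- The coefficients of the recurrence `hy n` sum to -4(2n+3)^3. Weighting `hy (n + 1)` by (2n+3)^3
and `hy n` by -(2n+5)^3 therefore annihilates constants, and the result is a recurrence in the
differences of y. -/
theorem gaugeOne_recurrence {y : ℕ → ℝ}
    (hy : ∀ n : ℕ, ((n : ℝ) + 2) ^ 3 * y (n + 2) - aperyPoly (n + 1) * y (n + 1)
      + ((n : ℝ) + 1) ^ 3 * y n = 0) (n : ℕ) :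
    gaugeOne (n + 2) * (y (n + 2 + 1) + -1 * y (n + 2)) =
      bOne (n + 2) * (gaugeOne (n + 1) * (y (n + 1 + 1) + -1 * y (n + 1)))
        + aOne (n + 2) * (gaugeOne n * (y (n + 1) + -1 * y n)) := by
  have h0 := hy n
  have h1 := hy (n + 1)
  simp only [gaugeOne, bOne, aOne, aperyPoly, if_neg (show n + 2 ≠ 0 by omega),
    if_neg (show n + 2 ≠ 1 by omega)] at h0 h1 ⊢
  push_cast at h0 h1 ⊢
  linear_combination (((n : ℝ) + 2) ^ 3 * (2 * (n : ℝ) + 1) ^ 3 * gaugeOne n) *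
    ((2 * (n : ℝ) + 3) ^ 3 * h1 - (2 * (n : ℝ) + 5) ^ 3 * h0)

/-- As for differences, with (-1)^n in place of constants: the alternating coefficient sum of `hy n`
is 6(2n+3)((n+2)^3 - (n+1)^3). -/
theorem gaugeTwo_recurrence {y : ℕ → ℝ}
    (hy : ∀ n : ℕ, ((n : ℝ) + 2) ^ 3 * y (n + 2) - aperyPoly (n + 1) * y (n + 1)
      + ((n : ℝ) + 1) ^ 3 * y n = 0) (n : ℕ) :
    gaugeTwo (n + 2) * (y (n + 2 + 1) + 1 * y (n + 2)) =
      bTwo (n + 2) * (gaugeTwo (n + 1) * (y (n + 1 + 1) + 1 * y (n + 1)))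
        + aTwo (n + 2) * (gaugeTwo n * (y (n + 1) + 1 * y n)) := by
  have h0 := hy n
  have h1 := hy (n + 1)
  simp only [gaugeTwo, bTwo, aTwo, aperyPoly, if_neg (show n + 2 ≠ 0 by omega),
    if_neg (show n + 2 ≠ 1 by omega)] at h0 h1 ⊢
  push_cast at h0 h1 ⊢
  linear_combination (((n : ℝ) + 2) ^ 3 * (2 * (n : ℝ) + 1) *
      (((n : ℝ) + 1) ^ 3 - (n : ℝ) ^ 3) * gaugeTwo n) *
    ((2 * (n : ℝ) + 3) * (((n : ℝ) + 2) ^ 3 - ((n : ℝ) + 1) ^ 3) * h1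
      + (2 * (n : ℝ) + 5) * (((n : ℝ) + 3) ^ 3 - ((n : ℝ) + 2) ^ 3) * h0)

theorem theoremA :
    (ExpandsTo (contFracOf aOne bOne) (2 * riemannZeta 3) ∧
      HasErrorRate (contFracOf aOne bOne) (2 * riemannZeta 3)) ∧
    (ExpandsTo (contFracOf aTwo bTwo) (2 * riemannZeta 3) ∧
      HasErrorRate (contFracOf aTwo bTwo) (2 * riemannZeta 3)) := by
  constructor
  -- The gauges start at 1/4 and 1/6 because A_1 - A_0 = 4 and A_1 + A_0 = 6, which makes Q_0 = 1.
  -- The exceptional a_1 comes from the companions: the recurrence extended one step back would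
  -- force B_1 = 5 B_0, but B_0 = 0 and B_1 = 6.
  · have h := contFracOf_nums_dens (a := aOne) (b := bOne)
      (N := fun n => 2 * (gaugeOne n * (aperyCompanion (n + 1) + -1 * aperyCompanion n)))
      (D := fun n => gaugeOne n * (aperyNum (n + 1) + -1 * aperyNum n))
      (by norm_num [gaugeOne, aperyCompanion_zero, aperyCompanion_one, bOne])
      (by norm_num [gaugeOne, aperyNum_zero, aperyNum_one])
      (by norm_num [gaugeOne, aperyCompanion_one, aperyCompanion_two, bOne, aOne])
      (by norm_num [gaugeOne, aperyNum_one, aperyNum_two, bOne])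
      (fun n => by linear_combination 2 * gaugeOne_recurrence aperyCompanion_recurrence n)
      (fun n => gaugeOne_recurrence aperyNum_recurrence n)
    exact expandsTo_and_hasErrorRate_of_apery (by simp) (fun n => (gaugeOne_pos n).ne')
      (fun n => (h n).2) (fun n => (h n).1)
  · have h := contFracOf_nums_dens (a := aTwo) (b := bTwo)
      (N := fun n => 2 * (gaugeTwo n * (aperyCompanion (n + 1) + 1 * aperyCompanion n)))
      (D := fun n => gaugeTwo n * (aperyNum (n + 1) + 1 * aperyNum n))
      (by norm_num [gaugeTwo, aperyCompanion_zero, aperyCompanion_one, bTwo])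
      (by norm_num [gaugeTwo, aperyNum_zero, aperyNum_one])
      (by norm_num [gaugeTwo, aperyCompanion_one, aperyCompanion_two, bTwo, aTwo])
      (by norm_num [gaugeTwo, aperyNum_one, aperyNum_two, bTwo])
      (fun n => by linear_combination 2 * gaugeTwo_recurrence aperyCompanion_recurrence n)
      (fun n => gaugeTwo_recurrence aperyNum_recurrence n)
    exact expandsTo_and_hasErrorRate_of_apery (by simp) (fun n => (gaugeTwo_pos n).ne')
      (fun n => (h n).2) (fun n => (h n).1)
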